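/- **Theorem (noncommutative Kashin–Temlyakov).** Let $M_N$ be the space of real $N\times N$ matrices, let $\|X\|_{S_p}$ be the Schatten $p$-norm (the $\ell_p$-norm of the vector of singular values of $X$), and for real $s>0$ let $\rho_s(X)_{S_1}=\inf\{\|X-Y\|_{S_1}: \operatorname{rank}(Y)\le s\}$. Let $1\le m<N^2$, let $\mathcal A:M_N\to\mathbb R^m$ be linear, and let $\Delta_1$ be a nuclear-norm reconstruction map for $\mathcal A$: for each $y$ in the range of $\mathcal A$, $\Delta_1(y)$ is some solution of the problem of minimizing $\|Z\|_{S_1}$ subject to $\mathcal AZ=y$. For constants $C,c_1,c_2>0$ consider the following properties. * MSCSP (matrix strong compressed sensing property) with constants $(C,c_1,c_2)$: for some real $s$ with $c_1\,m/N\le s\le c_2\,m/N$, $$\|X-\Delta_1(\mathcal AX)\|_{S_2}\le C s^{-1/2}\rho_s(X)_{S_1}\quad\text{for all }X\in M_N .$$ * MWCSP (matrix weak compressed sensing property) with constants $(C,c_1,c_2)$: for some real $s$ with $c_1\,m/N\le s\le c_2\,m/N$, $$\|X-\Delta_1(\mathcal AX)\|_{S_2}\le C s^{-1/2}\|X\|_{S_1}\quad\text{for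 all }X\in M_N .$$ * MWP (matrix width property) with constant $C$: $$\|X\|_{S_2}\le C (N/m)^{1/2}\|X\|_{S_1}\quad\text{for all }X\in\ker\mathcal A .$$ These three properties are equivalent up to a change in the constants: MSCSP implies MWCSP, MWCSP implies MWP, and MWP implies MSCSP, where in each implication the constants of the conclusion are positive and depend only on the constants of the hypothesis (not on $N$, $m$, $\mathcal A$, or the choice of $\Delta_1$). -/

import Mathlib

noncomputable section

namespace MatrixRecovery

/-- The Schatten `p`-(quasi-)norm of a real `N × N` matrix: the `ℓ_p`-(quasi-)norm of the vector of
its `N` singular values, listed with multiplicity. -/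
def schattenNorm {N : ℕ} (p : ℝ) (X : Matrix (Fin N) (Fin N) ℝ) : ℝ :=
  (∑ i : Fin N, (Matrix.toEuclideanLin X).singularValues i ^ p) ^ (1 / p)

/-- The best rank-`s` approximation error `ρ_s(X)` in the Schatten `p`-norm: the infimum of
`‖X - Y‖_{S_p}` over all `Y` with `rank Y ≤ s`, where `s ≥ 0` is real. -/
def rankApproxError {N : ℕ} (p s : ℝ) (X : Matrix (Fin N) (Fin N) ℝ) : ℝ :=
  sInf {r : ℝ | ∃ Y : Matrix (Fin N) (Fin N) ℝ, (Y.rank : ℝ) ≤ s ∧ r = schattenNorm p (X - Y)}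

/-- `Z` solves the problem: minimize `‖Z‖_{S_p}` subject to `A Z = y`. -/
def IsSchattenMinimizer {N m : ℕ} (p : ℝ) (A : Matrix (Fin N) (Fin N) ℝ →ₗ[ℝ] (Fin m → ℝ))
    (y : Fin m → ℝ) (Z : Matrix (Fin N) (Fin N) ℝ) : Prop :=
  A Z = y ∧ ∀ W : Matrix (Fin N) (Fin N) ℝ, A W = y → schattenNorm p Z ≤ schattenNorm p W

/-- `Δ` is a Schatten `p`-norm minimization reconstruction map for `A`: it assigns to every `y` in
the range of `A` a (not necessarily unique) solution of the minimization problem. -/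
def IsReconstructionMap {N m : ℕ} (p : ℝ) (A : Matrix (Fin N) (Fin N) ℝ →ₗ[ℝ] (Fin m → ℝ))
    (Δ : (Fin m → ℝ) → Matrix (Fin N) (Fin N) ℝ) : Prop :=
  ∀ y ∈ LinearMap.range A, IsSchattenMinimizer p A y (Δ y)

/-- Matrix Strong Compressed Sensing Property, with constants `C`, `c₁`, `c₂`; the relation
`s ≍ m / N` is the two-sided bound with the constants `c₁` and `c₂`. -/
def MSCSP {N m : ℕ} (A : Matrix (Fin N) (Fin N) ℝ →ₗ[ℝ] (Fin m → ℝ))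
    (Δ : (Fin m → ℝ) → Matrix (Fin N) (Fin N) ℝ) (C c₁ c₂ : ℝ) : Prop :=
  ∃ s : ℝ, c₁ * ((m : ℝ) / N) ≤ s ∧ s ≤ c₂ * ((m : ℝ) / N) ∧
    ∀ X : Matrix (Fin N) (Fin N) ℝ,
      schattenNorm 2 (X - Δ (A X)) ≤ C * s ^ (-(1 / 2) : ℝ) * rankApproxError 1 s X

/-- Matrix Weak Compressed Sensing Property, with constants `C`, `c₁`, `c₂`. -/
def MWCSP {N m : ℕ} (A : Matrix (Fin N) (Fin N) ℝ →ₗ[ℝ] (Fin m → ℝ))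
    (Δ : (Fin m → ℝ) → Matrix (Fin N) (Fin N) ℝ) (C c₁ c₂ : ℝ) : Prop :=
  ∃ s : ℝ, c₁ * ((m : ℝ) / N) ≤ s ∧ s ≤ c₂ * ((m : ℝ) / N) ∧
    ∀ X : Matrix (Fin N) (Fin N) ℝ,
      schattenNorm 2 (X - Δ (A X)) ≤ C * s ^ (-(1 / 2) : ℝ) * schattenNorm 1 X

/-- Matrix Width Property, with constant `C`. -/
def MWP {N m : ℕ} (A : Matrix (Fin N) (Fin N) ℝ →ₗ[ℝ] (Fin m → ℝ)) (C : ℝ) : Prop :=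
  ∀ X ∈ LinearMap.ker A,
    schattenNorm 2 X ≤ C * ((N : ℝ) / m) ^ (1 / 2 : ℝ) * schattenNorm 1 X

end MatrixRecovery

end

/-!
The strong property implies the weak one because `Y = 0` competes in the infimum defining `ρ_s`.
The weak property implies the width property because `Δ 0` minimizes the nuclear norm over
`ker A ∋ 0`, so `Δ 0 = 0`, and the reconstruction error of `X ∈ ker A` is `X` itself.

For the remaining implication let `H = X - Δ (A X) ∈ ker A` and let `Y` have rank at most `s`. With
the orthogonal projections `P` and `Q` onto the range and the corange of `Y`, split `H = W + R`,
where `W = (1 - P) H (1 - Q)`. The nuclear norm is additive on `Y` and `W`, so minimality of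
`Δ (A X) = X - H` gives `‖W‖_{S_1} ≤ ‖R‖_{S_1} + 2 ‖X - Y‖_{S_1}`. Since `R` has rank at most `2 s`
and is Hilbert–Schmidt orthogonal to `W`, Cauchy–Schwarz gives `‖R‖_{S_1} ≤ √(2 s) ‖H‖_{S_2}`, hence
`‖H‖_{S_1} ≤ 2 √(2 s) ‖H‖_{S_2} + 2 ‖X - Y‖_{S_1}`
(`LinearMap.nuclearNorm_sub_le_of_nuclearNorm_le`). The width property bounds `‖H‖_{S_2}` by
`‖H‖_{S_1}`, and for `s` a small multiple of `m / N` the first term on the right is absorbed.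

The facts about the nuclear norm (triangle inequality, additivity on orthogonal blocks) all come
from its duality with the operator norm: it is the maximum of `tr (U* T)` over contractions `U`
(`LinearMap.hsInner_le_nuclearNorm`, `LinearMap.exists_hsInner_eq_nuclearNorm`), which in turn is
read off from the singular value decomposition.
-/

open Module InnerProductSpace

section Operators

variable {E : Type*} [NormedAddCommGroup E] [InnerProductSpace ℝ E] [FiniteDimensional ℝ E]

namespace LinearMap

/-! ### The nuclear norm and its duality with the operator norm -/

/-- The nuclear norm (trace norm) of an endomorphism of a finite-dimensional Euclidean space: the
sum of its singular values. -/
noncomputable def nuclearNorm (T : End ℝ E) : ℝ :=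
  ∑ i ∈ Finset.range (finrank ℝ E), T.singularValues i

/-- The Hilbert–Schmidt inner product `tr (U* T)` of two endomorphisms. -/
noncomputable def hsInner (U T : End ℝ E) : ℝ :=
  LinearMap.trace ℝ E (star U * T)

theorem hsInner_eq_sum {ι : Type*} [Fintype ι] (b : OrthonormalBasis ι ℝ E) (U T : End ℝ E) :
    hsInner U T = ∑ i, ⟪U (b i), T (b i)⟫_ℝ := by
  rw [hsInner, LinearMap.trace_eq_sum_inner _ b]
  refine Finset.sum_congr rfl fun i _ => ?_
  rw [Module.End.mul_apply, LinearMap.star_eq_adjoint, LinearMap.adjoint_inner_right]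

theorem hsInner_add_right (U S T : End ℝ E) : hsInner U (S + T) = hsInner U S + hsInner U T := by
  simp [hsInner, mul_add]

theorem hsInner_add_left (U V T : End ℝ E) : hsInner (U + V) T = hsInner U T + hsInner V T := by
  simp [hsInner, add_mul]

theorem hsInner_mul_mul_left (A U B T : End ℝ E) :
    hsInner (A * U * B) T = hsInner U (star A * T * star B) := by
  rw [hsInner, hsInner, star_mul, star_mul, mul_assoc, LinearMap.trace_mul_comm]
  simp only [mul_assoc]

theorem hsInner_self_nonneg (T : End ℝ E) : 0 ≤ hsInner T T := by
  rw [hsInner_eq_sum (stdOrthonormalBasis ℝ E)]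
  exact Finset.sum_nonneg fun i _ => real_inner_self_nonneg

/-- Singular value decomposition, in the form used here: some orthonormal basis is mapped to an
orthogonal family whose lengths are the singular values. -/
theorem exists_orthonormalBasis_inner_map_eq (T : End ℝ E) :
    ∃ b : OrthonormalBasis (Fin (finrank ℝ E)) ℝ E, ∀ i j,
      ⟪T (b i), T (b j)⟫_ℝ = if i = j then T.singularValues i ^ 2 else 0 := by
  refine ⟨T.isSymmetric_adjoint_comp_self.eigenvectorBasis rfl, fun i j => ?_⟩
  rw [← LinearMap.adjoint_inner_right, ← LinearMap.comp_apply,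
    LinearMap.IsSymmetric.apply_eigenvectorBasis, inner_smul_right,
    orthonormal_iff_ite.mp (OrthonormalBasis.orthonormal _) i j]
  split_ifs with h
  · subst h
    rw [T.sq_singularValues_fin rfl i]
    simp
  · simp

theorem hsInner_self_eq_sum_sq (T : End ℝ E) :
    hsInner T T = ∑ i ∈ Finset.range (finrank ℝ E), T.singularValues i ^ 2 := by
  obtain ⟨b, hb⟩ := T.exists_orthonormalBasis_inner_map_eq
  rw [hsInner_eq_sum b, ← Fin.sum_univ_eq_sum_range (fun i => T.singularValues i ^ 2)]
  exact Finset.sum_congr rfl fun i _ => by rw [hb, if_pos rfl]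

/-- One half of the duality between the nuclear norm and the operator norm. -/
theorem hsInner_le_nuclearNorm {U : End ℝ E} (hU : ∀ x, ‖U x‖ ≤ ‖x‖) (T : End ℝ E) :
    hsInner U T ≤ nuclearNorm T := by
  obtain ⟨b, hb⟩ := T.exists_orthonormalBasis_inner_map_eq
  rw [hsInner_eq_sum b, nuclearNorm, ← Fin.sum_univ_eq_sum_range (fun i => T.singularValues i)]
  refine Finset.sum_le_sum fun i _ => ?_
  have hT : ‖T (b i)‖ = T.singularValues i := by
    rw [← sq_eq_sq₀ (norm_nonneg _) (T.singularValues_nonneg _), ← real_inner_self_eq_norm_sq, hb]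
    simp
  calc ⟪U (b i), T (b i)⟫_ℝ ≤ ‖U (b i)‖ * ‖T (b i)‖ := real_inner_le_norm _ _
    _ ≤ 1 * ‖T (b i)‖ := by
        gcongr
        simpa using hU (b i)
    _ = T.singularValues i := by rw [one_mul, hT]

/-- The other half of the duality: the partial isometry of the polar decomposition of `T` is a
contraction whose pairing with `T` is the nuclear norm. -/
theorem exists_hsInner_eq_nuclearNorm (T : End ℝ E) :
    ∃ U : End ℝ E, (∀ x, ‖U x‖ ≤ ‖x‖) ∧ hsInner U T = nuclearNorm T := by
  obtain ⟨b, hb⟩ := T.exists_orthonormalBasis_inner_map_eq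
  -- Where the singular value vanishes, the convention `0⁻¹ = 0` makes `U` vanish as well.
  let w : Fin (finrank ℝ E) → E := fun i => (T.singularValues i)⁻¹ • T (b i)
  have hw : ∀ i j, ⟪w i, w j⟫_ℝ =
      if i = j then ((T.singularValues i)⁻¹ * T.singularValues i) ^ 2 else 0 := by
    intro i j
    simp only [w, inner_smul_left, inner_smul_right, hb]
    split_ifs with h
    · subst h
      simp only [conj_trivial]
      ring
    · simp
  let U : End ℝ E := b.toBasis.constr ℝ w
  have hUb : ∀ i, U (b i) = w i := fun i => by
    rw [← b.coe_toBasis]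
    exact b.toBasis.constr_basis ℝ w i
  refine ⟨U, fun x => ?_, ?_⟩
  · have hUx : U x = ∑ i, ⟪b i, x⟫_ℝ • w i := by
      conv_lhs => rw [← b.sum_repr' x]
      simp [map_sum, hUb]
    rw [← sq_le_sq₀ (norm_nonneg _) (norm_nonneg _), ← b.sum_sq_inner_right x,
      ← real_inner_self_eq_norm_sq, hUx]
    simp only [sum_inner, inner_sum, inner_smul_left, inner_smul_right, hw, conj_trivial,
      mul_ite, mul_zero, Finset.sum_ite_eq', Finset.mem_univ, if_true]
    refine Finset.sum_le_sum fun i _ => ?_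
    have h1 : ((T.singularValues i)⁻¹ * T.singularValues i) ^ 2 ≤ 1 := by
      by_cases h : T.singularValues i = 0 <;> simp [h]
    nlinarith [sq_nonneg ⟪b i, x⟫_ℝ]
  · rw [hsInner_eq_sum b, nuclearNorm, ← Fin.sum_univ_eq_sum_range (fun i => T.singularValues i)]
    refine Finset.sum_congr rfl fun i _ => ?_
    rw [hUb]
    simp only [w, inner_smul_left, hb, conj_trivial, if_true]
    by_cases h : T.singularValues i = 0
    · simp [h]
    · field_simp

theorem nuclearNorm_add_le (S T : End ℝ E) :
    nuclearNorm (S + T) ≤ nuclearNorm S + nuclearNorm T := by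
  obtain ⟨U, hU, h⟩ := (S + T).exists_hsInner_eq_nuclearNorm
  rw [← h, hsInner_add_right]
  exact add_le_add (hsInner_le_nuclearNorm hU S) (hsInner_le_nuclearNorm hU T)

theorem nuclearNorm_neg (T : End ℝ E) : nuclearNorm (-T) = nuclearNorm T := by
  have key : ∀ S : End ℝ E, nuclearNorm (-S) ≤ nuclearNorm S := by
    intro S
    obtain ⟨U, hU, h⟩ := (-S).exists_hsInner_eq_nuclearNorm
    have h' : hsInner U (-S) = hsInner (-U) S := by simp [hsInner]
    rw [← h, h']
    exact hsInner_le_nuclearNorm (fun x => by simpa using hU x) S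
  exact le_antisymm (key T) (by simpa using key (-T))

theorem nuclearNorm_sub_le (S T : End ℝ E) :
    nuclearNorm (S - T) ≤ nuclearNorm S + nuclearNorm T := by
  simpa [sub_eq_add_neg, nuclearNorm_neg] using nuclearNorm_add_le S (-T)

theorem nuclearNorm_nonneg (T : End ℝ E) : 0 ≤ nuclearNorm T :=
  Finset.sum_nonneg fun i _ => T.singularValues_nonneg i

theorem eq_zero_of_nuclearNorm_eq_zero {T : End ℝ E} (h : nuclearNorm T = 0) : T = 0 := by
  rw [← T.singularValues_eq_zero_iff]
  ext i
  by_cases hi : i < finrank ℝ E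
  · exact (Finset.sum_eq_zero_iff_of_nonneg fun i _ => T.singularValues_nonneg i).mp h i
      (Finset.mem_range.mpr hi)
  · exact T.singularValues_of_finrank_le (not_lt.mp hi)

/-- Comparison of the nuclear and Hilbert–Schmidt norms: only `rank T` singular values are nonzero,
so this is the Cauchy–Schwarz inequality. -/
theorem nuclearNorm_le_sqrt_mul_sqrt {T : End ℝ E} {r : ℕ} (hr : finrank ℝ T.range ≤ r) :
    nuclearNorm T ≤ √r * √(hsInner T T) := by
  have hsub : Finset.range (finrank ℝ T.range) ⊆ Finset.range (finrank ℝ E) :=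
    Finset.range_mono T.range.finrank_le
  have h1 : nuclearNorm T = ∑ i ∈ Finset.range (finrank ℝ T.range), T.singularValues i := by
    refine (Finset.sum_subset hsub fun i _ hi => ?_).symm
    rw [T.singularValues_eq_zero_iff_le_finrank_range]
    simpa using hi
  have h2 : ∑ i ∈ Finset.range (finrank ℝ T.range), T.singularValues i ^ 2 ≤ hsInner T T := by
    rw [hsInner_self_eq_sum_sq]
    exact Finset.sum_le_sum_of_subset_of_nonneg hsub fun i _ _ => sq_nonneg _
  rw [← Real.sqrt_mul (Nat.cast_nonneg r)]
  refine Real.le_sqrt_of_sq_le ?_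
  rw [h1]
  refine sq_sum_le_card_mul_sum_sq.trans ?_
  rw [Finset.card_range]
  gcongr

/-! ### Orthogonal blocks and the cone condition -/

theorem star_starProjection (K : Submodule ℝ E) :
    star (K.starProjection : End ℝ E) = (K.starProjection : End ℝ E) :=
  (LinearMap.isSymmetric_iff_isSelfAdjoint _).mp K.starProjection_isSymmetric

theorem starProjection_mul_self (K : Submodule ℝ E) :
    (K.starProjection : End ℝ E) * (K.starProjection : End ℝ E) = (K.starProjection : End ℝ E) :=
  LinearMap.ext fun x => K.starProjection_eq_self_iff.mpr (K.starProjection_apply_mem x)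

theorem starProjection_range_mul (Y : End ℝ E) :
    (Y.range.starProjection : End ℝ E) * Y = Y :=
  LinearMap.ext fun x => Y.range.starProjection_eq_self_iff.mpr (Y.mem_range_self x)

theorem mul_starProjection_range_adjoint (Y : End ℝ E) :
    Y * ((adjoint Y).range.starProjection : End ℝ E) = Y := by
  have h := congrArg star (starProjection_range_mul (adjoint Y))
  rwa [star_mul, star_starProjection, ← LinearMap.star_eq_adjoint, star_star] at h

/-- The nuclear norm is additive on blocks with orthogonal ranges and orthogonal coranges: dual
certificates of the two blocks combine to a block diagonal contraction. -/
theorem nuclearNorm_add_nuclearNorm_le (K L : Submodule ℝ E) {Y W : End ℝ E}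
    (hYK : (K.starProjection : End ℝ E) * Y = Y) (hYL : Y * (L.starProjection : End ℝ E) = Y)
    (hWK : (K.starProjection : End ℝ E) * W = 0) (hWL : W * (L.starProjection : End ℝ E) = 0) :
    nuclearNorm Y + nuclearNorm W ≤ nuclearNorm (Y + W) := by
  obtain ⟨U, hU, hUY⟩ := Y.exists_hsInner_eq_nuclearNorm
  obtain ⟨V, hV, hVW⟩ := W.exists_hsInner_eq_nuclearNorm
  have hsP := star_starProjection K
  have hsQ := star_starProjection L
  have hsum : ∀ (M : Submodule ℝ E) (x : E), ‖x‖ ^ 2 =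
      ‖M.starProjection x‖ ^ 2 + ‖x - M.starProjection x‖ ^ 2 := by
    intro M x
    rw [M.norm_sq_eq_add_norm_sq_starProjection x, M.starProjection_orthogonal']
    rfl
  set P : End ℝ E := K.starProjection.toLinearMap with hP
  set Q : End ℝ E := L.starProjection.toLinearMap with hQ
  have hPP : P * P = P := starProjection_mul_self K
  have hpair : hsInner (P * U * Q + (1 - P) * V * (1 - Q)) (Y + W)
      = nuclearNorm Y + nuclearNorm W := by
    have e1 : P * (Y + W) * Q = Y := by rw [mul_add, hYK, hWK, add_zero, hYL]
    have e2 : (1 - P) * (Y + W) * (1 - Q) = W := by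
      have : (1 - P) * (Y + W) = W := by rw [sub_mul, one_mul, mul_add, hYK, hWK]; abel
      rw [this, mul_sub, hWL]; simp
    rw [hsInner_add_left, hsInner_mul_mul_left, hsInner_mul_mul_left, star_sub, star_sub, star_one,
      hsP, hsQ, e1, e2, hUY, hVW]
  rw [← hpair]
  refine hsInner_le_nuclearNorm (fun x => ?_) _
  set D : End ℝ E := P * U * Q + (1 - P) * V * (1 - Q) with hD
  have hPD : P * D = P * U * Q := by
    have : P * (1 - P) = 0 := by rw [mul_sub, hPP, mul_one, sub_self]
    rw [hD, mul_add, ← mul_assoc, ← mul_assoc, hPP, ← mul_assoc P, ← mul_assoc P, this]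
    simp
  have h1 : K.starProjection (D x) = K.starProjection (U (L.starProjection x)) :=
    LinearMap.congr_fun hPD x
  have h2 : D x - K.starProjection (D x) =
      V (x - L.starProjection x) - K.starProjection (V (x - L.starProjection x)) := by
    rw [h1]
    simp [hD, hP, hQ]
  rw [← sq_le_sq₀ (norm_nonneg _) (norm_nonneg _), hsum K (D x), hsum L x, h2, h1]
  refine add_le_add ?_ ?_
  · gcongr
    exact (K.norm_starProjection_apply_le _).trans (hU _)
  · refine le_trans ?_ (pow_le_pow_left₀ (norm_nonneg _) (hV (x - L.starProjection x)) 2)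
    have := hsum K (V (x - L.starProjection x))
    nlinarith [sq_nonneg ‖K.starProjection (V (x - L.starProjection x))‖]

/-- Splitting of `H` along a map `Y`: a block `W` that is invisible to the range and the corange of
`Y`, and a remainder of rank at most `2 * rank Y`, Hilbert–Schmidt orthogonal to `W`. -/
theorem exists_block_decomposition (Y H : End ℝ E) :
    ∃ W R : End ℝ E, H = W + R ∧ nuclearNorm Y + nuclearNorm W ≤ nuclearNorm (Y - W) ∧
      finrank ℝ R.range ≤ 2 * finrank ℝ Y.range ∧ hsInner R R ≤ hsInner H H := by
  have hY1 := starProjection_range_mul Y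
  have hY2 := mul_starProjection_range_adjoint Y
  have hsP := star_starProjection Y.range
  have hsQ := star_starProjection (adjoint Y).range
  have hPP := starProjection_mul_self Y.range
  have hQQ := starProjection_mul_self (adjoint Y).range
  have hadd := fun W : End ℝ E =>
    nuclearNorm_add_nuclearNorm_le Y.range (adjoint Y).range (Y := Y) (W := W)
  have hrP : finrank ℝ (range (Y.range.starProjection : End ℝ E)) = finrank ℝ Y.range := by
    refine congrArg (fun K : Submodule ℝ E => finrank ℝ K) ?_
    exact Submodule.range_starProjection _
  have hrQ : finrank ℝ (range ((adjoint Y).range.starProjection : End ℝ E)) =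
      finrank ℝ Y.range := by
    rw [← finrank_range_adjoint Y]
    refine congrArg (fun K : Submodule ℝ E => finrank ℝ K) ?_
    exact Submodule.range_starProjection _
  set P : End ℝ E := Y.range.starProjection.toLinearMap
  set Q : End ℝ E := (adjoint Y).range.starProjection.toLinearMap
  have hP1 : P * (1 - P) = 0 := by rw [mul_sub, hPP, mul_one, sub_self]
  have hQ1 : (1 - Q) * Q = 0 := by rw [sub_mul, hQQ, one_mul, sub_self]
  have hP2 : (1 - P) * (1 - P) = 1 - P := by rw [sub_mul, hP1, one_mul, sub_zero]
  have hQ2 : (1 - Q) * (1 - Q) = 1 - Q := by rw [mul_sub, hQ1, mul_one, sub_zero]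
  have hRe : H - (1 - P) * H * (1 - Q) = P * H + (1 - P) * H * Q := by noncomm_ring
  refine ⟨(1 - P) * H * (1 - Q), H - (1 - P) * H * (1 - Q), by abel, ?_, ?_, ?_⟩
  · have h := hadd (-((1 - P) * H * (1 - Q))) hY1 hY2
      (by rw [mul_neg, ← mul_assoc, ← mul_assoc, hP1]; simp)
      (by rw [neg_mul, mul_assoc, hQ1]; simp)
    rwa [nuclearNorm_neg, ← sub_eq_add_neg] at h
  · rw [hRe]
    have hle : range (P * H + (1 - P) * H * Q) ≤ range P ⊔ range ((1 - P) * H * Q) := by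
      rintro _ ⟨x, rfl⟩
      exact Submodule.add_mem_sup ⟨H x, rfl⟩ ⟨x, rfl⟩
    have hle2 : finrank ℝ (range ((1 - P) * H * Q)) ≤ finrank ℝ (range Q) := by
      rw [Module.End.mul_eq_comp _ Q, LinearMap.range_comp]
      exact Submodule.finrank_map_le _ _
    have := (Submodule.finrank_mono hle).trans (Submodule.finrank_add_le_finrank_add_finrank _ _)
    lia
  · set W := (1 - P) * H * (1 - Q) with hW
    have hWW : (1 - P) * W * (1 - Q) = W := by
      rw [hW, ← mul_assoc, ← mul_assoc, hP2, mul_assoc _ (1 - Q), hQ2]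
    have hWR : hsInner W (H - W) = 0 := by
      rw [hW, hsInner_mul_mul_left, ← hW, star_sub, star_sub, star_one, hsP, hsQ,
        mul_sub (1 - P), sub_mul, hWW, ← hW, sub_self]
      simp [hsInner]
    have hRW : hsInner (H - W) W = 0 := by
      rw [← hWR, hsInner_eq_sum (stdOrthonormalBasis ℝ E), hsInner_eq_sum (stdOrthonormalBasis ℝ E)]
      exact Finset.sum_congr rfl fun i _ => real_inner_comm _ _
    have hsplit : hsInner H H = hsInner W W + hsInner (H - W) (H - W) := by
      have : H = W + (H - W) := by abel
      conv_lhs => rw [this]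
      rw [hsInner_add_left, hsInner_add_right, hsInner_add_right, hWR, hRW]
      ring
    linarith [hsInner_self_nonneg W]

/-- The cone condition for nuclear norm minimization: if `Z` has nuclear norm at most that of `X`,
the nuclear norm of `X - Z` is controlled by its Hilbert–Schmidt norm and the distance of `X` to
any low rank map `Y`. -/
theorem nuclearNorm_sub_le_of_nuclearNorm_le {X Z : End ℝ E} (Y : End ℝ E)
    (hZ : nuclearNorm Z ≤ nuclearNorm X) :
    nuclearNorm (X - Z) ≤
      2 * (√(2 * finrank ℝ Y.range) * √(hsInner (X - Z) (X - Z))) + 2 * nuclearNorm (X - Y) := by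
  obtain ⟨W, R, hH, hYW, hR, hRH⟩ := exists_block_decomposition Y (X - Z)
  have h1 : nuclearNorm (Y - W) ≤ nuclearNorm Z + nuclearNorm (X - Y) + nuclearNorm R := by
    have e : Y - W = Z - (X - Y) + R := by
      have : R = X - Z - W := by rw [hH]; abel
      rw [this]; abel
    rw [e]
    exact (nuclearNorm_add_le _ _).trans (by gcongr; exact nuclearNorm_sub_le _ _)
  have h2 : nuclearNorm X ≤ nuclearNorm Y + nuclearNorm (X - Y) := by
    have := nuclearNorm_add_le Y (X - Y)
    rwa [add_sub_cancel] at this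
  have h3 : nuclearNorm (X - Z) ≤ nuclearNorm W + nuclearNorm R := hH ▸ nuclearNorm_add_le W R
  have h4 : nuclearNorm R ≤ √(2 * finrank ℝ Y.range) * √(hsInner (X - Z) (X - Z)) := by
    refine (nuclearNorm_le_sqrt_mul_sqrt hR).trans ?_
    push_cast
    gcongr
  linarith

end LinearMap

end Operators

/-! ### Schatten norms of matrices and the three properties -/

namespace MatrixRecovery

variable {N : ℕ}

theorem schattenNorm_one_eq (X : Matrix (Fin N) (Fin N) ℝ) :
    schattenNorm 1 X = LinearMap.nuclearNorm (Matrix.toEuclideanLin X) := by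
  simp [schattenNorm, LinearMap.nuclearNorm,
    Fin.sum_univ_eq_sum_range (fun i => (Matrix.toEuclideanLin X).singularValues i)]

theorem schattenNorm_two_eq (X : Matrix (Fin N) (Fin N) ℝ) :
    schattenNorm 2 X =
      √(LinearMap.hsInner (Matrix.toEuclideanLin X) (Matrix.toEuclideanLin X)) := by
  simp [schattenNorm, LinearMap.hsInner_self_eq_sum_sq, Real.sqrt_eq_rpow,
    Fin.sum_univ_eq_sum_range (fun i => (Matrix.toEuclideanLin X).singularValues i ^ 2)]

theorem schattenNorm_one_nonneg (X : Matrix (Fin N) (Fin N) ℝ) : 0 ≤ schattenNorm 1 X :=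
  schattenNorm_one_eq X ▸ LinearMap.nuclearNorm_nonneg _

theorem schattenNorm_one_zero : schattenNorm 1 (0 : Matrix (Fin N) (Fin N) ℝ) = 0 := by
  simp [schattenNorm_one_eq, LinearMap.nuclearNorm]

theorem eq_zero_of_schattenNorm_one_nonpos {X : Matrix (Fin N) (Fin N) ℝ}
    (h : schattenNorm 1 X ≤ 0) : X = 0 := by
  have h0 := le_antisymm h (schattenNorm_one_nonneg X)
  rw [schattenNorm_one_eq] at h0
  exact (LinearEquiv.map_eq_zero_iff _).mp (LinearMap.eq_zero_of_nuclearNorm_eq_zero h0)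

theorem finrank_range_toEuclideanLin (Y : Matrix (Fin N) (Fin N) ℝ) :
    finrank ℝ (LinearMap.range (Matrix.toEuclideanLin Y)) = Y.rank := by
  rw [Matrix.toEuclideanLin, Matrix.toLpLin_eq_toLin, ← Matrix.rank_eq_finrank_range_toLin]

theorem rankApproxError_le_schattenNorm {s : ℝ} (hs : 0 ≤ s) (X : Matrix (Fin N) (Fin N) ℝ) :
    rankApproxError 1 s X ≤ schattenNorm 1 X := by
  refine csInf_le ⟨0, ?_⟩ ⟨0, by simpa using hs, by simp⟩
  rintro _ ⟨Y, -, rfl⟩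
  exact schattenNorm_one_nonneg _

theorem le_mul_rankApproxError {s K a : ℝ} (hs : 0 ≤ s) (hK : 0 < K)
    {X : Matrix (Fin N) (Fin N) ℝ}
    (h : ∀ Y : Matrix (Fin N) (Fin N) ℝ, (Y.rank : ℝ) ≤ s → a ≤ K * schattenNorm 1 (X - Y)) :
    a ≤ K * rankApproxError 1 s X := by
  rw [← div_le_iff₀' hK]
  refine le_csInf ⟨_, 0, by simpa using hs, rfl⟩ ?_
  rintro _ ⟨Y, hY, rfl⟩
  rw [div_le_iff₀' hK]
  exact h Y hY

theorem schattenNorm_one_sub_le {X Z : Matrix (Fin N) (Fin N) ℝ} (Y : Matrix (Fin N) (Fin N) ℝ)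
    (hZ : schattenNorm 1 Z ≤ schattenNorm 1 X) :
    schattenNorm 1 (X - Z) ≤
      2 * (√(2 * Y.rank) * schattenNorm 2 (X - Z)) + 2 * schattenNorm 1 (X - Y) := by
  rw [schattenNorm_one_eq, schattenNorm_one_eq] at hZ
  rw [schattenNorm_one_eq, schattenNorm_one_eq, schattenNorm_two_eq, map_sub, map_sub,
    ← finrank_range_toEuclideanLin]
  exact LinearMap.nuclearNorm_sub_le_of_nuclearNorm_le _ hZ

theorem IsReconstructionMap.sub_mem_ker {m : ℕ} {A : Matrix (Fin N) (Fin N) ℝ →ₗ[ℝ] (Fin m → ℝ)}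
    {Δ : (Fin m → ℝ) → Matrix (Fin N) (Fin N) ℝ} (hΔ : IsReconstructionMap 1 A Δ)
    (X : Matrix (Fin N) (Fin N) ℝ) : X - Δ (A X) ∈ LinearMap.ker A := by
  rw [LinearMap.mem_ker, map_sub, (hΔ (A X) ⟨X, rfl⟩).1, sub_self]

theorem MSCSP.mwcsp {m : ℕ} {A : Matrix (Fin N) (Fin N) ℝ →ₗ[ℝ] (Fin m → ℝ)}
    {Δ : (Fin m → ℝ) → Matrix (Fin N) (Fin N) ℝ} {C c₁ c₂ : ℝ} (hC : 0 ≤ C) (hc₁ : 0 ≤ c₁)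
    (h : MSCSP A Δ C c₁ c₂) : MWCSP A Δ C c₁ c₂ := by
  obtain ⟨s, h1, h2, h3⟩ := h
  have hs : 0 ≤ s := le_trans (by positivity) h1
  refine ⟨s, h1, h2, fun X => (h3 X).trans ?_⟩
  gcongr
  exact rankApproxError_le_schattenNorm hs X

/-- On the kernel of `A` the reconstruction is `0`, the only matrix of nuclear norm at most `0`. -/
theorem MWCSP.mwp {m : ℕ} {A : Matrix (Fin N) (Fin N) ℝ →ₗ[ℝ] (Fin m → ℝ)}
    {Δ : (Fin m → ℝ) → Matrix (Fin N) (Fin N) ℝ} {C c₁ c₂ : ℝ} (hC : 0 ≤ C) (hc₁ : 0 < c₁)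
    (hN : 0 < N) (hm : 0 < m) (hΔ : IsReconstructionMap 1 A Δ) (h : MWCSP A Δ C c₁ c₂) :
    MWP A (C * c₁ ^ (-(1 / 2) : ℝ)) := by
  obtain ⟨s, h1, -, h3⟩ := h
  intro X hX
  have hX0 : A X = 0 := hX
  have hΔ0 : Δ (A X) = 0 := by
    refine eq_zero_of_schattenNorm_one_nonpos ?_
    rw [← schattenNorm_one_zero (N := N)]
    exact (hΔ (A X) ⟨X, rfl⟩).2 0 (by rw [hX0, map_zero])
  have h4 := h3 X
  rw [hΔ0, sub_zero] at h4
  refine h4.trans (mul_le_mul_of_nonneg_right ?_ (schattenNorm_one_nonneg X))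
  have hq : (0 : ℝ) < m / N := by positivity
  calc C * s ^ (-(1 / 2) : ℝ) ≤ C * (c₁ * (m / N)) ^ (-(1 / 2) : ℝ) := by
        refine mul_le_mul_of_nonneg_left ?_ hC
        exact Real.rpow_le_rpow_of_nonpos (by positivity) h1 (by norm_num)
    _ = C * c₁ ^ (-(1 / 2) : ℝ) * ((N : ℝ) / m) ^ (1 / 2 : ℝ) := by
        rw [Real.mul_rpow hc₁.le hq.le, Real.rpow_neg hq.le, ← Real.inv_rpow hq.le, inv_div]
        ring

/-- The cone condition turns the width bound on the kernel into instance optimality: with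
`s = m / (32 C² N)` the Hilbert–Schmidt term on the right is absorbed by the left-hand side. -/
theorem MWP.mscsp {m : ℕ} {A : Matrix (Fin N) (Fin N) ℝ →ₗ[ℝ] (Fin m → ℝ)}
    {Δ : (Fin m → ℝ) → Matrix (Fin N) (Fin N) ℝ} {C : ℝ} (hC : 0 < C)
    (hN : 0 < N) (hm : 0 < m) (hΔ : IsReconstructionMap 1 A Δ) (h : MWP A C) :
    MSCSP A Δ 1 (1 / (32 * C ^ 2)) (1 / (32 * C ^ 2)) := by
  have hN' : (0 : ℝ) < N := by exact_mod_cast hN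
  have hm' : (0 : ℝ) < m := by exact_mod_cast hm
  set s : ℝ := 1 / (32 * C ^ 2) * (m / N) with hs
  have hs0 : 0 < s := by positivity
  refine ⟨s, le_rfl, le_rfl, fun X => ?_⟩
  set a : ℝ := C * ((N : ℝ) / m) ^ (1 / 2 : ℝ) with ha
  have ha0 : 0 < a := by positivity
  -- The constant `32` is chosen so that the term `2 * a * √(2 * s) * ‖X - Δ (A X)‖` produced by
  -- the cone condition is half of the left-hand side and can be absorbed.
  have hav : a * √(2 * s) = 1 / 4 := by
    rw [← sq_eq_sq₀ (by positivity) (by norm_num), mul_pow, Real.sq_sqrt (by positivity), ha,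
      mul_pow, ← Real.sqrt_eq_rpow, Real.sq_sqrt (by positivity), hs]
    field_simp
    norm_num
  have hK : 4 * a ≤ s ^ (-(1 / 2) : ℝ) := by
    rw [Real.rpow_neg hs0.le, ← Real.sqrt_eq_rpow, le_inv_comm₀ (by positivity) (by positivity)]
    calc √s ≤ √(2 * s) := Real.sqrt_le_sqrt (by linarith)
      _ = (4 * a)⁻¹ := by
        refine eq_inv_of_mul_eq_one_right ?_
        linarith
  rw [one_mul]
  refine le_mul_rankApproxError hs0.le (by positivity) fun Y hY => ?_
  refine le_trans ?_ (mul_le_mul_of_nonneg_right hK (schattenNorm_one_nonneg _))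
  have hcone := schattenNorm_one_sub_le Y ((hΔ (A X) ⟨X, rfl⟩).2 X rfl)
  have hwidth := h _ (hΔ.sub_mem_ker X)
  have hx0 : 0 ≤ schattenNorm 2 (X - Δ (A X)) :=
    schattenNorm_two_eq (X - Δ (A X)) ▸ Real.sqrt_nonneg _
  set x := schattenNorm 2 (X - Δ (A X))
  have hr : √(2 * Y.rank) * x ≤ √(2 * s) * x := by gcongr
  have : x ≤ a * (2 * (√(2 * s) * x) + 2 * schattenNorm 1 (X - Y)) :=
    hwidth.trans (mul_le_mul_of_nonneg_left (by linarith) ha0.le)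
  have e : a * (2 * (√(2 * s) * x) + 2 * schattenNorm 1 (X - Y)) =
      2 * (a * √(2 * s)) * x + 2 * a * schattenNorm 1 (X - Y) := by ring
  rw [e, hav] at this
  linarith

end MatrixRecovery

theorem mainTheorem4 :
    -- strong property implies weak property
    (∀ C c₁ c₂ : ℝ, 0 < C → 0 < c₁ → 0 < c₂ →
      ∃ C' c₁' c₂' : ℝ, 0 < C' ∧ 0 < c₁' ∧ 0 < c₂' ∧
        ∀ (N m : ℕ), 0 < m → m < N ^ 2 →
          ∀ (A : Matrix (Fin N) (Fin N) ℝ →ₗ[ℝ] (Fin m → ℝ))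
            (Δ : (Fin m → ℝ) → Matrix (Fin N) (Fin N) ℝ),
            MatrixRecovery.IsReconstructionMap 1 A Δ →
              MatrixRecovery.MSCSP A Δ C c₁ c₂ → MatrixRecovery.MWCSP A Δ C' c₁' c₂') ∧
    -- weak property implies width property
    (∀ C c₁ c₂ : ℝ, 0 < C → 0 < c₁ → 0 < c₂ →
      ∃ C' : ℝ, 0 < C' ∧
        ∀ (N m : ℕ), 0 < m → m < N ^ 2 →
          ∀ (A : Matrix (Fin N) (Fin N) ℝ →ₗ[ℝ] (Fin m → ℝ))
            (Δ : (Fin m → ℝ) → Matrix (Fin N) (Fin N) ℝ),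
            MatrixRecovery.IsReconstructionMap 1 A Δ →
              MatrixRecovery.MWCSP A Δ C c₁ c₂ → MatrixRecovery.MWP A C') ∧
    -- width property implies strong property
    (∀ C : ℝ, 0 < C →
      ∃ C' c₁' c₂' : ℝ, 0 < C' ∧ 0 < c₁' ∧ 0 < c₂' ∧
        ∀ (N m : ℕ), 0 < m → m < N ^ 2 →
          ∀ (A : Matrix (Fin N) (Fin N) ℝ →ₗ[ℝ] (Fin m → ℝ))
            (Δ : (Fin m → ℝ) → Matrix (Fin N) (Fin N) ℝ),
            MatrixRecovery.IsReconstructionMap 1 A Δ →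
              MatrixRecovery.MWP A C → MatrixRecovery.MSCSP A Δ C' c₁' c₂') := by
  refine ⟨fun C c₁ c₂ hC hc₁ hc₂ => ⟨C, c₁, c₂, hC, hc₁, hc₂, ?_⟩,
    fun C c₁ c₂ hC hc₁ _ => ⟨C * c₁ ^ (-(1 / 2) : ℝ), by positivity, ?_⟩,
    fun C hC => ⟨1, 1 / (32 * C ^ 2), 1 / (32 * C ^ 2), one_pos, by positivity, by positivity, ?_⟩⟩
  · intro N m _ _ A Δ _ h
    exact h.mwcsp hC.le hc₁.le
  · intro N m hm hmN A Δ hΔ h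
    exact h.mwp hC.le hc₁ (Nat.pos_of_ne_zero fun h0 => by simp [h0] at hmN) hm hΔ
  · intro N m hm hmN A Δ hΔ h
    exact h.mscsp hC (Nat.pos_of_ne_zero fun h0 => by simp [h0] at hmN) hm hΔ
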